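/- All topological groups are Hausdorff, and all function spaces below carry subspace topologies as indicated. Let $Y$ be a metrizable non-compact abelian topological group (written additively). Let $X$ be a $Y$-Tychonoff space, i.e. a topological space such that for every closed $A\subseteq X$, every $y_0\in Y$, every finite $F\subseteq X\setminus A$ and every $f:F\to Y$ there is a continuous $\bar f:X\to Y$ with $\bar f|_F=f$ and $\bar f(A)\subseteq\{y_0\}$. Let $C_p(X,Y)$ be the group of continuous functions $X\to Y$ with the topology of pointwise convergence, and let $E$ be a subgroup of $C_p(X,Y)$, with the subspace topology, such that (a) $E$ contains all constant functions and is relatively $Y_p$-Tychonoff: for every closed $A\subseteq X$, finite $F\subseteq X\setminus A$, $y_0\in Y$ and $f\in C_p(X,Y)$ there is $\bar f\in E$ with $\bar f|_F=f|_F$ and $\bar f(A)\subseteq\{y_0\}$; (b) if $Y$ is non-discrete, then $E$ has the $p$-approximation property: every $y_0\in Y$ has a base $\mathcal V$ of open neighborhoods such that for every $V\in\mathcal V$, closed $A\subseteq X$, finite $F\subseteq X\setminus A$ and $f:F\to V$ there is $\bar f\in E$ with $\bar f(X)\subseteq V$, $\bar f|_F=f$ and $\bar f(A)\subseteq\{y_0\}$.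 Then the following assertions are equivalent: (i) $E$ is $\kappa$-Fréchet–Urysohn: for every open $U\subseteq E$ and every $g\in\overline U$ there is a sequence in $U$ converging to $g$; (ii) $E$ is Ascoli: every compact subset $K$ of the space $C_k(E)$ of continuous functions $E\to\mathbb R$ with the compact-open topology is evenly continuous, i.e. the evaluation map $K\times E\to\mathbb R$, $(\varphi,g)\mapsto\varphi(g)$, is continuous; (iii) $E$ is sequentially Ascoli: every convergent sequence in $C_k(E)$, taken together with its limit, is evenly continuous; (iv) the sequential closure $[U]_s$ of every open set $U\subseteq E$ is closed in $E$, where $[U]_s=\bigcup_{\alpha<\omega_1}[U]_\alpha$, $[U]_0=U$ and, for $0<\alpha<\omega_1$, $[U]_\alpha$ is the set of all limits in $E$ of convergent sequences of points of $\bigcup_{i<\alpha}[U]_i$; (v) $X$ has the property $(\kappa)$: every sequence $(A_n)_{n\in\mathbb N}$ of pairwise disjoint finite subsets of $X$ has a subsequence $(A_{n_k})_{k\in\mathbb N}$ for which there are open sets $U_k\supseteq A_{n_k}$ of $X$ such that each point of $X$ belongs to $U_k$ for only finitely many $k$. -/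

import Mathlib

open Set Filter Topology

/-- The group `C_p(X, Y)` of continuous functions `X → Y`, as a subgroup of the product group
`X → Y`. It and all its subgroups carry the topology of pointwise convergence, i.e. the subspace
topology of the product topology on `X → Y`. -/
def Cp (X Y : Type*) [TopologicalSpace X] [TopologicalSpace Y] [AddCommGroup Y]
    [IsTopologicalAddGroup Y] : AddSubgroup (X → Y) where
  carrier := {f | Continuous f}
  zero_mem' := continuous_zero
  add_mem' := fun hf hg => Continuous.add hf hg
  neg_mem' := fun hf => Continuous.neg hf

/-- `X` is `Y`-Tychonoff: every function on a finite set `F` disjoint from a closed set `A`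
extends to a continuous function on `X` that is constantly `y₀` on `A`. -/
def IsYTychonoff (X Y : Type*) [TopologicalSpace X] [TopologicalSpace Y] : Prop :=
  ∀ (A : Set X), IsClosed A → ∀ (y₀ : Y) (F : Finset X), Disjoint (F : Set X) A →
    ∀ f : F → Y, ∃ g : X → Y, Continuous g ∧ (∀ x : F, g x = f x) ∧ g '' A ⊆ {y₀}

/-- `E` is relatively `Y_p`-Tychonoff (for a set `E` of continuous functions). -/
def IsRelativelyYpTychonoff {X Y : Type*} [TopologicalSpace X] [TopologicalSpace Y]
    (E : Set (X → Y)) : Prop :=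
  ∀ (A : Set X), IsClosed A → ∀ F : Finset X, Disjoint (F : Set X) A →
    ∀ (y₀ : Y) (f : X → Y), Continuous f →
      ∃ g ∈ E, (∀ x ∈ F, g x = f x) ∧ g '' A ⊆ {y₀}

/-- `H ⊆ Y^X` has the `p`-approximation property at `y₀`. The family `V` is an open base of
neighborhoods of `y₀`. -/
def HasPApproximationAt {X Y : Type*} [TopologicalSpace X] [TopologicalSpace Y]
    (H : Set (X → Y)) (y₀ : Y) : Prop :=
  ∃ 𝓥 : Set (Set Y), (∀ V ∈ 𝓥, IsOpen V ∧ y₀ ∈ V) ∧ (∀ W ∈ 𝓝 y₀, ∃ V ∈ 𝓥, V ⊆ W) ∧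
    ∀ V ∈ 𝓥, ∀ A : Set X, IsClosed A → ∀ F : Finset X, Disjoint (F : Set X) A →
      ∀ f : F → Y, (∀ x, f x ∈ V) →
        ∃ g ∈ H, range g ⊆ V ∧ (∀ x : F, g x = f x) ∧ g '' A ⊆ {y₀}

/-- The `p`-approximation property: at each point of `Y`. -/
def HasPApproximation {X Y : Type*} [TopologicalSpace X] [TopologicalSpace Y]
    (H : Set (X → Y)) : Prop :=
  ∀ y₀ : Y, HasPApproximationAt H y₀

/-- `Z` is `κ`-Fréchet–Urysohn. -/
def IsKappaFrechetUrysohn (Z : Type*) [TopologicalSpace Z] : Prop :=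
  ∀ U : Set Z, IsOpen U → ∀ z ∈ closure U, ∃ u : ℕ → Z, (∀ n, u n ∈ U) ∧ Tendsto u atTop (𝓝 z)

/-- A set `K` of continuous real functions is evenly continuous if evaluation `K × Z → ℝ` is
continuous, where `C(Z, ℝ)` carries the compact-open topology and `K` the subspace topology. -/
def IsEvenlyContinuous {Z : Type*} [TopologicalSpace Z] (K : Set C(Z, ℝ)) : Prop :=
  Continuous fun p : K × Z => (p.1 : C(Z, ℝ)) p.2

/-- The Tychonoff space `Z` is Ascoli. -/
def IsAscoli (Z : Type*) [TopologicalSpace Z] [T35Space Z] : Prop :=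
  ∀ K : Set C(Z, ℝ), IsCompact K → IsEvenlyContinuous K

/-- The Tychonoff space `Z` is sequentially Ascoli: every convergent sequence in `C(Z, ℝ)`
with the compact-open topology, taken together with its limit, is evenly continuous. -/
def IsSequentiallyAscoli (Z : Type*) [TopologicalSpace Z] [T35Space Z] : Prop :=
  ∀ (f : ℕ → C(Z, ℝ)) (g : C(Z, ℝ)), Tendsto f atTop (𝓝 g) →
    IsEvenlyContinuous (insert g (range f))

open Classical in
/-- The transfinite iterates `[A]_α`: `[A]_0 = A`, and for `α > 0`, `[A]_α` is the set of limits of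
convergent sequences in `⋃_{i < α} [A]_i`. (Mathlib's `seqClosure` is the set of all limits of
sequences lying in a set.) -/
noncomputable def iterSeqClosure {Z : Type*} [TopologicalSpace Z] (A : Set Z)
    (α : Ordinal.{0}) : Set Z :=
  if α = 0 then A else seqClosure (⋃ i : Iio α, iterSeqClosure A i.1)
termination_by α
decreasing_by exact i.2

/-- The sequential closure `[A]_s = ⋃_{α < ω₁} [A]_α`. -/
noncomputable def sequentialClosure {Z : Type*} [TopologicalSpace Z] (A : Set Z) : Set Z :=
  ⋃ α : Iio (Ordinal.omega 1 : Ordinal.{0}), iterSeqClosure A α.1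

/-- A family of sets is point-finite if each point lies in only finitely many members. -/
def IsPointFinite {ι X : Type*} (A : ι → Set X) : Prop :=
  ∀ x, {i | x ∈ A i}.Finite

/-- A family of sets is strongly point-finite if it has a point-finite open expansion. -/
def IsStronglyPointFinite {ι X : Type*} [TopologicalSpace X] (A : ι → Set X) : Prop :=
  ∃ U : ι → Set X, (∀ i, IsOpen (U i) ∧ A i ⊆ U i) ∧ IsPointFinite U

/-- The property `(κ)`: every pairwise disjoint sequence of finite sets has a strongly point-finite
subsequence. -/
def HasPropertyKappa (X : Type*) [TopologicalSpace X] : Prop :=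
  ∀ A : ℕ → Set X, (∀ n, (A n).Finite) → (∀ m n, m ≠ n → Disjoint (A m) (A n)) →
    ∃ φ : ℕ → ℕ, StrictMono φ ∧ IsStronglyPointFinite fun n => A (φ n)

/-! Suppose `(κ)` fails for finite sets `A n`. Non-compactness of `Y` gives points `y n` and bumps
`b n` with `b n (y n) = 1`, only finitely many of which are nonzero somewhere on a given compact
set. Put `Φ n f = ∏ a ∈ A n, b n (f a)`. Interpolating `y n` on `A n` and `0` on a given finite set
shows that the level sets `Φ n = 1` accumulate at `0`. If infinitely many `Φ n` were nonzero on a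
compact `K ⊆ E`, the open sets where `b n ∘ f ≠ 0`, for witnesses `f ∈ K`, would expand a
subsequence of `A`, point-finitely because each `{f x | f ∈ K}` is compact. Such a family refutes
both the sequential Ascoli property and closedness of sequential closures.

Conversely, assume `(κ)` and let `0` be adherent to an open `U`. Choose finite sets `F n` increasing
with `n` and `f n ∈ U`, small on `F n`, such that agreeing with `f n` on `F (n + 1)` forces
membership in `U`. Apply `(κ)` to the differences `F (n + 1) \ F n`; each chosen `f n` can then be
altered within `U` to be small off the corresponding open set. Point-finiteness makes the altered
functions tend to `0`. -/

/-! ### Consequences of the `κ`-Fréchet–Urysohn property. -/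

/-- A `κ`-Fréchet–Urysohn Tychonoff space is Ascoli. -/
theorem IsKappaFrechetUrysohn.isAscoli {Z : Type*} [TopologicalSpace Z] [T35Space Z]
    (h : IsKappaFrechetUrysohn Z) : IsAscoli Z := by
  intro K hK
  have key : ∀ z₀ : Z, ∀ ε > 0, ∀ᶠ z in 𝓝 z₀, ∀ f ∈ K, |f z - f z₀| ≤ ε := by
    intro z₀ ε hε
    by_contra hcon
    set U : Set Z := {z | ∃ f ∈ K, ε < |f z - f z₀|} with hU
    have hUo : IsOpen U := by
      have : U = ⋃ f ∈ K, {z | ε < |f z - f z₀|} := by ext; simp [hU]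
      rw [this]
      exact isOpen_biUnion fun f _ => isOpen_lt continuous_const (by fun_prop)
    have hz : z₀ ∈ closure U := by
      rw [mem_closure_iff_frequently]
      intro h'
      refine hcon (h'.mono fun z hz f hf => ?_)
      by_contra h''
      exact hz ⟨f, hf, not_le.1 h''⟩
    obtain ⟨u, huU, hu⟩ := h U hUo z₀ hz
    choose f hfK hf using huU
    obtain ⟨f₀, -, hf₀⟩ := hK.exists_mapClusterPt (u := f) (f := atTop)
      (tendsto_principal.2 (Eventually.of_forall hfK))
    -- `Z` need not be locally compact; restricting to the compact `C` makes evaluation jointly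
    -- continuous. A cluster point `f₀` suffices, so no convergent subsequence of `f` is needed.
    let C : Set Z := insert z₀ (range u)
    have hC : IsCompact C := hu.isCompact_insert_range
    have : CompactSpace C := isCompact_iff_compactSpace.1 hC
    let r : C(C, Z) := ⟨Subtype.val, continuous_subtype_val⟩
    have hev : Continuous fun p : C(Z, ℝ) × C => p.1 p.2.1 := by
      have h1 : Continuous fun p : C(Z, ℝ) × C => ((p.1.comp r) p.2 : ℝ) :=
        (((ContinuousMap.continuous_precomp r).comp continuous_fst).eval continuous_snd)
      exact h1
    let c₀ : C := ⟨z₀, mem_insert _ _⟩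
    have hosc : Continuous fun p : C(Z, ℝ) × C => |p.1 p.2.1 - p.1 z₀| :=
      (hev.sub (hev.comp (continuous_fst.prodMk continuous_const : Continuous
        fun p : C(Z, ℝ) × C => (p.1, c₀)))).abs
    have hnear : ∀ᶠ p : C(Z, ℝ) × C in 𝓝 f₀ ×ˢ 𝓝 c₀, |p.1 p.2.1 - p.1 z₀| < ε := by
      rw [← nhds_prod_eq]
      exact hosc.continuousAt.eventually_lt continuousAt_const (by simpa [c₀] using hε)
    obtain ⟨P, hP, Q, hQ, hPQ⟩ := Filter.eventually_prod_iff.1 hnear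
    have huC : Tendsto (fun n => (⟨u n, mem_insert_of_mem _ (mem_range_self n)⟩ : C)) atTop
        (𝓝 c₀) := tendsto_subtype_rng.2 hu
    obtain ⟨n, hn1, hn2⟩ := ((hf₀.frequently hP).and_eventually (huC.eventually hQ)).exists
    exact (hPQ hn1 hn2).not_gt (hf n)
  rw [IsEvenlyContinuous, continuous_iff_continuousAt]
  rintro ⟨f₀, z₀⟩
  rw [Metric.continuousAt_iff', nhds_prod_eq]
  intro ε hε
  have h1 : ∀ᶠ f : K in 𝓝 f₀, |f.1 z₀ - f₀.1 z₀| < ε / 2 := by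
    have : Continuous fun f : K => |f.1 z₀ - f₀.1 z₀| :=
      (((continuous_eval_const z₀).comp continuous_subtype_val).sub
        continuous_const).abs
    exact this.continuousAt.eventually_lt continuousAt_const (by simpa using hε)
  filter_upwards [h1.prod_mk (key z₀ (ε / 2) (half_pos hε))] with p hp
  have h2 := hp.2 p.1.1 p.1.2
  rw [Real.dist_eq]
  calc |p.1.1 p.2 - f₀.1 z₀| ≤ |p.1.1 p.2 - p.1.1 z₀| + |p.1.1 z₀ - f₀.1 z₀| := abs_sub_le _ _ _
    _ < ε := by linarith [hp.1]

/-- An Ascoli space is sequentially Ascoli. -/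
theorem IsAscoli.isSequentiallyAscoli {Z : Type*} [TopologicalSpace Z] [T35Space Z]
    (h : IsAscoli Z) : IsSequentiallyAscoli Z :=
  fun _ _ hfg => h _ hfg.isCompact_insert_range

theorem iterSeqClosure_zero {Z : Type*} [TopologicalSpace Z] (A : Set Z) :
    iterSeqClosure A 0 = A := by
  rw [iterSeqClosure, if_pos rfl]

theorem iterSeqClosure_of_ne_zero {Z : Type*} [TopologicalSpace Z] (A : Set Z)
    {α : Ordinal.{0}} (hα : α ≠ 0) :
    iterSeqClosure A α = seqClosure (⋃ i : Iio α, iterSeqClosure A i.1) := by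
  rw [iterSeqClosure, if_neg hα]

theorem subset_sequentialClosure {Z : Type*} [TopologicalSpace Z] (A : Set Z) :
    A ⊆ sequentialClosure A := fun z hz =>
  mem_iUnion.2 ⟨⟨0, Ordinal.omega_pos 1⟩, by rwa [iterSeqClosure_zero]⟩

theorem seqClosure_subset_sequentialClosure {Z : Type*} [TopologicalSpace Z] (A : Set Z) :
    seqClosure A ⊆ sequentialClosure A := by
  rintro z ⟨u, hu, hz⟩
  have h1 : (1 : Ordinal.{0}) < Ordinal.omega 1 :=
    Ordinal.one_lt_omega0.trans_le (Ordinal.omega0_le_omega 1)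
  refine mem_iUnion.2 ⟨⟨1, h1⟩, ?_⟩
  rw [iterSeqClosure_of_ne_zero A one_ne_zero]
  exact ⟨u, fun n => mem_iUnion.2 ⟨⟨0, mem_Iio.2 zero_lt_one⟩, by
    rw [iterSeqClosure_zero]; exact hu n⟩, hz⟩

/-- A sequentially closed set containing `A` contains the sequential closure of `A`. -/
theorem sequentialClosure_subset {Z : Type*} [TopologicalSpace Z] {A C : Set Z}
    (hC : IsSeqClosed C) (hAC : A ⊆ C) : sequentialClosure A ⊆ C := by
  refine iUnion_subset fun α => ?_
  induction α.1 using WellFoundedLT.induction with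
  | ind α ih =>
    by_cases h0 : α = 0
    · rwa [h0, iterSeqClosure_zero]
    · rw [iterSeqClosure_of_ne_zero A h0]
      rintro z ⟨u, hu, hz⟩
      exact hC (fun n => iUnion_subset (fun i : Iio α => ih i.1 i.2) (hu n)) hz

/-- In a `κ`-Fréchet–Urysohn space sequential closures of open sets are closed. -/
theorem IsKappaFrechetUrysohn.isClosed_sequentialClosure {Z : Type*} [TopologicalSpace Z]
    (h : IsKappaFrechetUrysohn Z) {U : Set Z} (hU : IsOpen U) :
    IsClosed (sequentialClosure U) := by
  have : sequentialClosure U = closure U :=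
    (sequentialClosure_subset isClosed_closure.isSeqClosed subset_closure).antisymm
      fun z hz => seqClosure_subset_sequentialClosure U (h U hU z hz)
  rw [this]
  exact isClosed_closure

/-! ### Compact-finite families as obstructions. -/

/-- The functions `Φ n` form a compact-finite family whose `1`-level sets accumulate at `z₀`. -/
structure IsCompactFiniteAccumulatingAt {Z : Type*} [TopologicalSpace Z] (Φ : ℕ → C(Z, ℝ))
    (z₀ : Z) : Prop where
  finite_of_isCompact : ∀ K : Set Z, IsCompact K → {n | ∃ z ∈ K, Φ n z ≠ 0}.Finite
  eventually_exists : ∀ O ∈ 𝓝 z₀, ∀ᶠ n in atTop, ∃ z ∈ O, Φ n z = 1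

namespace IsCompactFiniteAccumulatingAt

variable {Z : Type*} [TopologicalSpace Z] {Φ : ℕ → C(Z, ℝ)} {z₀ : Z}

theorem eventually_eq_zero (h : IsCompactFiniteAccumulatingAt Φ z₀) {K : Set Z}
    (hK : IsCompact K) : ∀ᶠ n in atTop, ∀ z ∈ K, Φ n z = 0 := by
  have := (h.finite_of_isCompact K hK).eventually_cofinite_notMem
  rw [Nat.cofinite_eq_atTop] at this
  filter_upwards [this] with n hn z hz
  by_contra h0
  exact hn ⟨z, hz, h0⟩

/-- Compact-finiteness gives `Φ n → 0` in the compact-open topology, yet `Φ n` takes the value `1`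
arbitrarily near `z₀`, so evaluation is discontinuous at `(0, z₀)`. -/
theorem not_isSequentiallyAscoli [T35Space Z] (h : IsCompactFiniteAccumulatingAt Φ z₀) :
    ¬ IsSequentiallyAscoli Z := by
  intro hZ
  have hlim : Tendsto Φ atTop (𝓝 0) := by
    rw [ContinuousMap.tendsto_iff_forall_isCompact_tendstoUniformlyOn]
    intro K hK
    rw [Metric.tendstoUniformlyOn_iff]
    intro ε hε
    filter_upwards [h.eventually_eq_zero hK] with n hn z hz
    simpa [hn z hz] using hε
  have hev := hZ Φ 0 hlim
  let k : ℕ → (insert 0 (range Φ) : Set C(Z, ℝ)) :=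
    fun n => ⟨Φ n, mem_insert_of_mem _ (mem_range_self n)⟩
  let k₀ : (insert 0 (range Φ) : Set C(Z, ℝ)) := ⟨0, mem_insert _ _⟩
  have hk : Tendsto k atTop (𝓝 k₀) := tendsto_subtype_rng.2 hlim
  have hlt : ∀ᶠ p : (insert 0 (range Φ) : Set C(Z, ℝ)) × Z in 𝓝 k₀ ×ˢ 𝓝 z₀,
      p.1.1 p.2 < 1 := by
    rw [← nhds_prod_eq]
    exact hev.continuousAt.eventually_lt continuousAt_const (by simp [k₀])
  obtain ⟨P, hP, Q, hQ, hPQ⟩ := Filter.eventually_prod_iff.1 hlt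
  obtain ⟨n, hn, z, hz, hnz⟩ := ((hk.eventually hP).and (h.eventually_exists _ hQ)).exists
  exact (hPQ hn hz).ne hnz

/-- A convergent sequence with its limit is compact, so it meets only finitely many of the closed
sets `1 / 2 ≤ Φ n`; hence their union is sequentially closed. Discarding the finitely many `n` with
`Φ n z₀ ≠ 0` keeps `z₀` out of it, though `z₀` is adherent to the union of the sets `1 / 2 < Φ n`.
-/
theorem exists_isOpen_not_isClosed_sequentialClosure (h : IsCompactFiniteAccumulatingAt Φ z₀) :
    ∃ U : Set Z, IsOpen U ∧ ¬ IsClosed (sequentialClosure U) := by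
  obtain ⟨N, hN⟩ := eventually_atTop.1 (h.eventually_eq_zero (isCompact_singleton (x := z₀)))
  let U : Set Z := ⋃ n ≥ N, {z | 1 / 2 < Φ n z}
  let C : Set Z := ⋃ n ≥ N, {z | 1 / 2 ≤ Φ n z}
  have hUC : U ⊆ C := iUnion₂_mono fun n _ z (hz : 1 / 2 < Φ n z) => hz.le
  have hC : IsSeqClosed C := by
    intro u z hu hz
    obtain ⟨M, hM⟩ := eventually_atTop.1 (h.eventually_eq_zero hz.isCompact_insert_range)
    have hu' : ∀ k, u k ∈ ⋃ n ∈ Ico N M, {z | 1 / 2 ≤ Φ n z} := by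
      intro k
      obtain ⟨n, hn, hnk⟩ := mem_iUnion₂.1 (hu k)
      refine mem_iUnion₂.2 ⟨n, ⟨hn, lt_of_not_ge fun hMn => ?_⟩, hnk⟩
      have h0 := hM n hMn (u k) (mem_insert_of_mem _ (mem_range_self k))
      have h1 : 1 / 2 ≤ Φ n (u k) := hnk
      norm_num [h0] at h1
    have hcl : IsClosed (⋃ n ∈ Ico N M, {z | 1 / 2 ≤ Φ n z}) :=
      (finite_Ico N M).isClosed_biUnion fun n _ => isClosed_le continuous_const (Φ n).continuous
    obtain ⟨n, hn, hnz⟩ := mem_iUnion₂.1 (hcl.mem_of_tendsto hz (Eventually.of_forall hu'))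
    exact mem_iUnion₂.2 ⟨n, hn.1, hnz⟩
  refine ⟨U, isOpen_biUnion fun n _ => isOpen_lt continuous_const (Φ n).continuous,
    fun hcl => ?_⟩
  have hz₀ : z₀ ∈ closure U := by
    refine mem_closure_iff_nhds.2 fun O hO => ?_
    obtain ⟨n, ⟨z, hzO, hz⟩, hn⟩ := ((h.eventually_exists O hO).and (eventually_ge_atTop N)).exists
    refine ⟨z, hzO, mem_iUnion₂.2 ⟨n, hn, ?_⟩⟩
    rw [mem_ofPred_eq, hz]
    norm_num
  have hmem := sequentialClosure_subset hC hUC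
    (closure_minimal (subset_sequentialClosure U) hcl hz₀)
  obtain ⟨n, hn, hnz⟩ := mem_iUnion₂.1 hmem
  have h1 : 1 / 2 ≤ Φ n z₀ := hnz
  norm_num [hN n hn z₀ rfl] at h1

end IsCompactFiniteAccumulatingAt

/-! ### Necessity of `(κ)`. -/

/-- A non-compact metrizable space carries a compact-finite sequence of bump functions. -/
theorem exists_compactFinite_bumps (Y : Type*) [TopologicalSpace Y]
    [TopologicalSpace.MetrizableSpace Y] [NoncompactSpace Y] :
    ∃ (y : ℕ → Y) (b : ℕ → Y → ℝ), (∀ n, Continuous (b n)) ∧ (∀ n, b n (y n) = 1) ∧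
      ∀ K : Set Y, IsCompact K → {n | ∃ z ∈ K, b n z ≠ 0}.Finite := by
  let _ := TopologicalSpace.metrizableSpaceMetric Y
  have hY : ¬ IsSeqCompact (univ : Set Y) := fun h =>
    noncompact_univ Y (isCompact_iff_isSeqCompact.2 h)
  simp only [IsSeqCompact, not_forall] at hY
  obtain ⟨y, -, hy⟩ := hY
  have hr : Tendsto (fun n : ℕ => 1 / ((n : ℝ) + 1)) atTop (𝓝 0) :=
    tendsto_one_div_add_atTop_nhds_zero_nat
  -- The radii `1 / (n + 1)` tend to `0`: if a compact set met infinitely many supports, a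
  -- convergent subsequence of the meeting points would yield one of `y`, which has none.
  refine ⟨y, fun n z => max 0 (1 - (n + 1) * dist z (y n)), fun n => by fun_prop,
    fun n => by simp, fun K hK => ?_⟩
  by_contra hinf
  obtain ⟨φ, hφ, hφK⟩ := extraction_of_frequently_atTop (Nat.frequently_atTop_iff_infinite.2 hinf)
  choose z hzK hz using hφK
  obtain ⟨a, -, ψ, hψ, ha⟩ := hK.isSeqCompact hzK
  refine hy ⟨a, mem_univ a, φ ∘ ψ, hφ.comp hψ, ?_⟩
  have hdist : ∀ k, dist (z k) (y (φ k)) ≤ 1 / ((φ k : ℝ) + 1) := by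
    intro k
    by_contra hlt
    rw [not_le, div_lt_iff₀ (by positivity)] at hlt
    exact hz k (max_eq_left (by linarith))
  exact ha.congr_dist (squeeze_zero (fun _ => dist_nonneg) (fun k => hdist (ψ k))
    (hr.comp (hφ.comp hψ).tendsto_atTop))

/-- If `Y` has two points, then a `Y`-Tychonoff space is Hausdorff as soon as `Y` is. -/
theorem IsYTychonoff.t2Space {X Y : Type*} [TopologicalSpace X] [TopologicalSpace Y] [T2Space Y]
    [Nontrivial Y] (hX : IsYTychonoff X Y) : T2Space X := by
  classical
  refine ⟨fun x x' hne => ?_⟩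
  obtain ⟨y, y', hy⟩ := exists_pair_ne Y
  obtain ⟨g, hg, hgF, -⟩ := hX ∅ isClosed_empty y {x, x'} (by simp)
    (fun t => if t.1 = x then y else y')
  refine separated_by_continuous hg ?_
  have h1 : g x = y := by simpa using hgF ⟨x, by simp⟩
  have h2 : g x' = y' := by simpa [hne.symm] using hgF ⟨x', by simp⟩
  rwa [h1, h2]

/-- If `E` is a space of continuous functions that interpolates arbitrary values on finite sets,
then failure of `(κ)` yields a compact-finite sequence of functions on `E` accumulating at `0`. -/
theorem exists_isCompactFiniteAccumulatingAt {X Y : Type*} [TopologicalSpace X]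
    [TopologicalSpace Y] [AddCommGroup Y] [TopologicalSpace.MetrizableSpace Y] [NoncompactSpace Y]
    (E : AddSubgroup (X → Y)) (hE : ∀ f ∈ E, Continuous f)
    (hint : ∀ (F : Finset X) (f : X → Y), ∃ g ∈ E, ∀ x ∈ F, g x = f x)
    (hκ : ¬ HasPropertyKappa X) :
    ∃ Φ : ℕ → C(E, ℝ), IsCompactFiniteAccumulatingAt Φ 0 := by
  classical
  obtain ⟨y, b, hb, hby, hbK⟩ := exists_compactFinite_bumps Y
  simp only [HasPropertyKappa, not_forall] at hκ
  obtain ⟨A, hA, hdisj, hno⟩ := hκ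
  have heval : ∀ x : X, Continuous fun f : E => f.1 x := fun x =>
    (continuous_apply x).comp continuous_subtype_val
  refine ⟨fun n => ⟨fun f => ∏ a ∈ (hA n).toFinset, b n (f.1 a),
    continuous_finsetProd _ fun a _ => (hb n).comp (heval a)⟩, ⟨fun K hK => ?_, fun O hO => ?_⟩⟩
  · by_contra hinf
    obtain ⟨φ, hφ, hφK⟩ := extraction_of_frequently_atTop
      (Nat.frequently_atTop_iff_infinite.2 hinf)
    choose f hfK hf using hφK
    refine hno ⟨φ, hφ, fun k => {x | b (φ k) ((f k).1 x) ≠ 0}, fun k => ⟨?_, fun a ha => ?_⟩,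
      fun x => ?_⟩
    · exact isOpen_ne_fun ((hb _).comp (hE _ (f k).2)) continuous_const
    · exact Finset.prod_ne_zero_iff.1 (hf k) a ((hA _).mem_toFinset.2 ha)
    · refine ((hbK _ (hK.image (heval x))).preimage hφ.injective.injOn).subset fun k hk => ?_
      exact ⟨_, mem_image_of_mem _ (hfK k), hk⟩
  · obtain ⟨O', hO', hOO⟩ := mem_nhds_subtype _ _ _ |>.1 hO
    rw [nhds_pi, Filter.mem_pi] at hO'
    obtain ⟨I, hI, t, ht, htO⟩ := hO'
    -- By disjointness a point lies in at most one `A n`, so eventually `A n` misses `I` and the two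
    -- interpolation conditions do not conflict.
    have hmeet : ∀ x, {n | x ∈ A n}.Finite := fun x =>
      Set.Subsingleton.finite fun m hm n hn => by
        by_contra hmn
        exact (hdisj m n hmn).notMem_of_mem_left hm hn
    have hev : ∀ᶠ n in atTop, ∀ x ∈ I, x ∉ A n := by
      rw [← Nat.cofinite_eq_atTop, hI.eventually_all]
      exact fun x _ => (hmeet x).eventually_cofinite_notMem
    filter_upwards [hev] with n hn
    obtain ⟨g, hgE, hg⟩ := hint (hI.toFinset ∪ (hA n).toFinset)
      (fun x => if x ∈ A n then y n else 0)
    refine ⟨⟨g, hgE⟩, hOO (htO fun x hx => ?_), ?_⟩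
    · have : g x = 0 := by rw [hg x (by simp [hx]), if_neg (hn x hx)]
      change g x ∈ t x
      rw [this]
      exact mem_of_mem_nhds (ht x)
    · refine Finset.prod_eq_one fun a ha => ?_
      have : g a = y n := by
        rw [hg a (Finset.mem_union_right _ ha), if_pos ((hA n).mem_toFinset.1 ha)]
      change b n (g a) = 1
      rw [this, hby]

/-! ### Sufficiency of `(κ)`. -/

/-- A countable base at `0` along which functions of `E` with values in a basic neighborhood can be
interpolated by functions in `E` with values in the same neighborhood. -/
theorem exists_nhds_zero_interpolation {X Y : Type*} [TopologicalSpace X]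
    [TopologicalSpace Y] [AddCommGroup Y] [TopologicalSpace.MetrizableSpace Y]
    (E : AddSubgroup (X → Y))
    (happrox : ¬ DiscreteTopology Y → HasPApproximation (E : Set (X → Y))) :
    ∃ V : ℕ → Set Y, (∀ n, V n ∈ 𝓝 0) ∧ (∀ W ∈ 𝓝 (0 : Y), ∀ᶠ n in atTop, V n ⊆ W) ∧
      ∀ n (F : Finset X) (f : X → Y), (∀ x ∈ F, f x ∈ V n) →
        ∃ g ∈ E, (∀ x, g x ∈ V n) ∧ ∀ x ∈ F, g x = f x := by
  by_cases hd : DiscreteTopology Y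
  -- For discrete `Y` the data to interpolate are all `0`, and the zero function does it.
  · exact ⟨fun _ => {0}, fun _ => by simp,
      fun W hW => Eventually.of_forall fun _ => singleton_subset_iff.2 (mem_of_mem_nhds hW),
      fun n F f hf => ⟨0, E.zero_mem, fun _ => rfl, fun x hx => (hf x hx).symm⟩⟩
  · obtain ⟨𝓥, h𝓥, hbase, hint⟩ := happrox hd 0
    obtain ⟨B, hB⟩ := (𝓝 (0 : Y)).exists_antitone_basis
    choose V hV hVB using fun n => hbase (B n) (hB.mem n)
    refine ⟨V, fun n => (h𝓥 _ (hV n)).1.mem_nhds (h𝓥 _ (hV n)).2, fun W hW => ?_,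
      fun n F f hf => ?_⟩
    · filter_upwards [hB.eventually_subset hW] with n hn using (hVB n).trans hn
    · obtain ⟨g, hgE, hgV, hgF, -⟩ := hint (V n) (hV n) ∅ isClosed_empty F (by simp)
        (fun x => f x) (fun x => hf x x.2)
      exact ⟨g, hgE, fun x => hgV (mem_range_self x), fun x hx => hgF ⟨x, hx⟩⟩

/-- Sufficiency of `(κ)`: limit points of open sets, at the origin. -/
theorem HasPropertyKappa.exists_seq_tendsto_zero {X Y : Type*} [TopologicalSpace X] [T1Space X]
    [TopologicalSpace Y] [AddCommGroup Y] [TopologicalSpace.MetrizableSpace Y]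
    (E : AddSubgroup (X → Y)) (hE : ∀ f ∈ E, Continuous f)
    (hETych : IsRelativelyYpTychonoff (E : Set (X → Y)))
    (happrox : ¬ DiscreteTopology Y → HasPApproximation (E : Set (X → Y)))
    (hκ : HasPropertyKappa X) {U : Set E} (hU : IsOpen U) (h0 : 0 ∈ closure U) :
    ∃ u : ℕ → E, (∀ n, u n ∈ U) ∧ Tendsto u atTop (𝓝 0) := by
  classical
  obtain ⟨V, hV, hVW, hVint⟩ := exists_nhds_zero_interpolation E happrox
  have step : ∀ (n : ℕ) (F : Finset X), ∃ (f : E) (F' : Finset X), F ⊆ F' ∧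
      (∀ x ∈ F, f.1 x ∈ V n) ∧ ∀ h : E, (∀ x ∈ F', h.1 x = f.1 x) → h ∈ U := by
    intro n F
    have hO : {f : E | ∀ x ∈ F, f.1 x ∈ V n} ∈ 𝓝 (0 : E) := by
      refine (Filter.eventually_all_finset F).2 fun x _ => ?_
      have hx : Continuous fun f : E => f.1 x := (continuous_apply x).comp continuous_subtype_val
      exact hx.continuousAt.eventually_mem (hV n)
    obtain ⟨f, hfO, hfU⟩ := mem_closure_iff_nhds.1 h0 _ hO
    obtain ⟨O', hO', hOU⟩ := mem_nhds_subtype _ _ _ |>.1 (hU.mem_nhds hfU)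
    rw [nhds_pi, Filter.mem_pi] at hO'
    obtain ⟨I, hI, t, ht, htO⟩ := hO'
    refine ⟨f, F ∪ hI.toFinset, Finset.subset_union_left, hfO, fun h hh => hOU (htO fun x hx => ?_)⟩
    rw [hh x (by simp [hx])]
    exact mem_of_mem_nhds (ht x)
  choose f N hFN hfV hfU using step
  obtain ⟨F, hFs⟩ : ∃ F : ℕ → Finset X, ∀ n, F (n + 1) = N n (F n) :=
    ⟨fun n => Nat.rec ∅ N n, fun _ => rfl⟩
  have hFmono : Monotone F := monotone_nat_of_le_succ fun n => (hFN n (F n)).trans (hFs n).ge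
  let A : ℕ → Set X := fun n => ↑(F (n + 1) \ F n)
  have hAdisj : ∀ m n, m < n → Disjoint (A m) (A n) := by
    intro m n hmn
    refine Set.disjoint_left.2 fun x hxm hxn => ?_
    simp only [A, Finset.mem_coe, Finset.mem_sdiff] at hxm hxn
    exact hxn.2 (hFmono (Nat.succ_le_of_lt hmn) hxm.1)
  obtain ⟨φ, hφ, W, hW, hWfin⟩ := hκ A (fun n => Finset.finite_toSet _) fun m n hmn =>
    hmn.lt_or_gt.elim (hAdisj m n) fun h => (hAdisj n m h).symm
  have main : ∀ k, ∃ h ∈ U, ∀ x ∉ W k, h.1 x ∈ V (φ k) := by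
    intro k
    set n := φ k
    -- Split the correction as `p + q`: `p` carries `f n (F n)` on `F (n + 1) \ F n` and vanishes on
    -- `D`; `q` carries it on `F n`, vanishes on the difference, and stays in `V n` everywhere. Off
    -- `W k` only `q` remains.
    let D : Set X := (W k)ᶜ ∪ (F n : Set X)
    have hD : IsClosed D := (hW k).1.isClosed_compl.union (F n).finite_toSet.isClosed
    have hdisj : Disjoint ((F (n + 1) \ F n : Finset X) : Set X) D := by
      refine Set.disjoint_left.2 fun x hx hxD => ?_
      rcases hxD with hxD | hxD
      · exact hxD ((hW k).2 hx)
      · exact (Finset.mem_sdiff.1 hx).2 hxD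
    obtain ⟨p, hpE, hpf, hpD⟩ := hETych D hD _ hdisj 0 (f n (F n)).1 (hE _ (f n (F n)).2)
    have hp0 : ∀ x ∈ D, p x = 0 := fun x hx => hpD (mem_image_of_mem p hx)
    obtain ⟨q, hqE, hqV, hqF⟩ := hVint n (F (n + 1))
      (fun x => if x ∈ F n then (f n (F n)).1 x else 0) fun x _ => by
        split_ifs with hx
        · exact hfV n (F n) x hx
        · exact mem_of_mem_nhds (hV n)
    refine ⟨⟨p + q, E.add_mem hpE hqE⟩, hfU n (F n) _ fun x hx => ?_, fun x hx => ?_⟩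
    · rw [← hFs] at hx
      by_cases hxF : x ∈ F n
      · simp [hp0 x (Or.inr hxF), hqF x hx, hxF]
      · simp [hpf x (Finset.mem_sdiff.2 ⟨hx, hxF⟩), hqF x hx, hxF]
    · simpa [hp0 x (Or.inl hx)] using hqV x
  choose h hhU hhV using main
  refine ⟨h, hhU, tendsto_subtype_rng.2 (tendsto_pi_nhds.2 fun x => ?_)⟩
  refine tendsto_def.2 fun O hO => ?_
  have h1 : ∀ᶠ k in atTop, x ∉ W k := by
    rw [← Nat.cofinite_eq_atTop]
    exact (hWfin x).eventually_cofinite_notMem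
  filter_upwards [h1, hφ.tendsto_atTop.eventually (hVW O hO)] with k hk1 hk2
  exact hk2 (hhV k x hk1)

/-- If the origin is a sequential limit of every open set adherent to it, then a topological group
is `κ`-Fréchet–Urysohn. -/
theorem isKappaFrechetUrysohn_of_zero {G : Type*} [TopologicalSpace G] [AddGroup G]
    [IsTopologicalAddGroup G]
    (h : ∀ U : Set G, IsOpen U → 0 ∈ closure U →
      ∃ u : ℕ → G, (∀ n, u n ∈ U) ∧ Tendsto u atTop (𝓝 0)) : IsKappaFrechetUrysohn G := by
  intro U hU g hg
  obtain ⟨u, hu, hu0⟩ := h ((fun x => x + g) ⁻¹' U) (hU.preimage (continuous_add_const g)) (by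
    have := (Homeomorph.addRight g).preimage_closure U
    have hmem : (0 : G) ∈ Homeomorph.addRight g ⁻¹' closure U := by simpa using hg
    rw [this] at hmem
    exact hmem)
  exact ⟨fun n => u n + g, hu, by simpa using hu0.add_const g⟩

theorem theoremt {X : Type*} {Y : Type*} [TopologicalSpace X]
    [TopologicalSpace Y] [AddCommGroup Y] [IsTopologicalAddGroup Y]
    [TopologicalSpace.MetrizableSpace Y] [NoncompactSpace Y]
    (hX : IsYTychonoff X Y)
    (E : AddSubgroup (X → Y)) (hE : E ≤ Cp X Y)
    (hETych : IsRelativelyYpTychonoff (E : Set (X → Y)))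
    (hconst : ∀ y : Y, (fun _ : X => y) ∈ E)
    (happrox : ¬ DiscreteTopology Y → HasPApproximation (E : Set (X → Y))) :
    List.TFAE
      [IsKappaFrechetUrysohn E,
        IsAscoli E,
        IsSequentiallyAscoli E,
        ∀ U : Set E, IsOpen U → IsClosed (sequentialClosure U),
        HasPropertyKappa X] := by
  have : Nontrivial Y := by
    by_contra hn
    rw [not_nontrivial_iff_subsingleton] at hn
    exact noncompact_univ Y (Set.subsingleton_univ.isCompact)
  have := hX.t2Space
  have hint : ∀ (F : Finset X) (f : X → Y), ∃ g ∈ E, ∀ x ∈ F, g x = f x := by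
    intro F f
    obtain ⟨g, hg, hgF, -⟩ := hX ∅ isClosed_empty 0 F (by simp) fun x => f x
    obtain ⟨g', hg'E, hg', -⟩ := hETych ∅ isClosed_empty F (by simp) 0 g hg
    exact ⟨g', hg'E, fun x hx => (hg' x hx).trans (hgF ⟨x, hx⟩)⟩
  tfae_have 1 → 2 := fun h => h.isAscoli
  tfae_have 2 → 3 := fun h => h.isSequentiallyAscoli
  tfae_have 3 → 5 := fun h => by
    by_contra hκ
    obtain ⟨Φ, hΦ⟩ := exists_isCompactFiniteAccumulatingAt E hE hint hκ
    exact hΦ.not_isSequentiallyAscoli h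
  tfae_have 1 → 4 := fun h U hU => h.isClosed_sequentialClosure hU
  tfae_have 4 → 5 := fun h => by
    by_contra hκ
    obtain ⟨Φ, hΦ⟩ := exists_isCompactFiniteAccumulatingAt E hE hint hκ
    obtain ⟨U, hU, hcl⟩ := hΦ.exists_isOpen_not_isClosed_sequentialClosure
    exact hcl (h U hU)
  tfae_have 5 → 1 := fun h => isKappaFrechetUrysohn_of_zero fun U hU h0 =>
    h.exists_seq_tendsto_zero E hE hETych happrox hU h0
  tfae_finish
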